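/- Let $s\ge 0$, $p_1$, $k$ be integers, $p_2=2s+1$, $r_2=s$, $r_1=p_1-1$, $s+1\le p_1\le 2s+1$ and $k\ge\max\{2(s+1)-p_1,\,2\}$. For $(p,r)=(p_i,r_i)$, $i=1,2$, let $N_j^{p,r}:[0,1]\to\mathbb R$, $j=0,\dots,n_i-1$, with $n_i=p_i+1+k(p_i-r_i)$, be the B-splines of degree $p$ for the knot vector in which $0$ and $1$ occur $p+1$ times and each $\frac{m}{k+1}$, $m=1,\dots,k$, occurs $p-r$ times, and let $N_{j_1,j_2}^{p,r}(x,y)=N_{j_1}^{p,r}(x)N_{j_2}^{p,r}(y)$ on $[0,1]^2$. For each $i=0,\dots,n_1-1$ there are unique real numbers $\mu_j^{(i)}$ with $N_i^{p_1,r_1}=\sum_{j=0}^{n_2-1}\mu_j^{(i)}N_j^{p_2,r_2}$. Let $\overline N_i=\sum_{j=s+1}^{n_2-s-2}\mu_j^{(i)}N_j^{p_2,r_2}$ be the truncated B-splines and $\overline N_{j_1,j_2}(x,y)=\overline N_{j_1}(x)\overline N_{j_2}(y)$. Put $M_i=\{s+1,\dots,n_i-s-2\}$ for $i=1,2$, $O_1=\{1,\dots,s\}\cup\{n_1-s-1,\dots,n_1-2\}$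 and $O_2=\{0,\dots,s\}\cup\{n_2-s-1,\dots,n_2-1\}$, and define $$\mathcal S_1=\operatorname{span}\{N^{p_1,r_1}_{j_1,j_2}: j_1,j_2\in M_1\},$$ $$\overline{\mathcal S}_1=\operatorname{span}\{\overline N_{j_1,j_2}: j_1\in O_1,\ 1\le j_2\le n_1-2\}+\operatorname{span}\{\overline N_{j_1,j_2}: j_1\in M_1,\ j_2\in O_1\},$$ $$\mathcal S_2=\operatorname{span}\{N^{p_2,r_2}_{j_1,j_2}: j_1\in O_2,\ 0\le j_2\le n_2-1\}+\operatorname{span}\{N^{p_2,r_2}_{j_1,j_2}: j_1\in M_2,\ j_2\in O_2\}.$$ Then all the functions listed in these definitions are together linearly independent. Hence the two sums inside $\overline{\mathcal S}_1$ and $\mathcal S_2$ are direct, so is the sum $\mathcal S=\mathcal S_1\oplus\overline{\mathcal S}_1\oplus\mathcal S_2$, and these functions form a basis of the mixed degree and regularity space $\mathcal S$. Moreover, $$\dim\mathcal S=4(s+1)^2(k+1)+(k+s)^2+(p_1-(s+1))(p_1+2k+s-1).$$ -/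

import Mathlib

open Finset

noncomputable section

namespace MixedSpline

/-- The closed unit interval. -/
abbrev I01 : Type := Set.Icc (0 : ℝ) 1

/-- Number of B-splines of degree `p` and regularity `r` with `k` inner breakpoints:
`n_{p,r} = p + 1 + k (p - r)`. -/
def numBSplines (p r k : ℕ) : ℕ := p + 1 + k * (p - r)

/-- The open knot vector (indexed from `0`): the knot `0` repeated `p + 1` times, each
`m / (k + 1)` for `m = 1, …, k` repeated `p - r` times, the knot `1` repeated `p + 1` times.
It has `numBSplines p r k + p + 1` entries; later entries (never used) are `1`. -/
def knot (p r k i : ℕ) : ℝ :=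
  if i ≤ p then 0
  else if i < numBSplines p r k then (((i - (p + 1)) / (p - r) + 1 : ℕ) : ℝ) / ((k : ℝ) + 1)
  else 1

/-- Normalized B-splines over a knot sequence `t` with last knot `1`, by the Cox-de Boor recursion;
terms with a zero denominator are zero. Degree-zero B-splines are indicators of half-open
knot intervals, except that the last nonempty one is closed at `1`. -/
def coxDeBoor (t : ℕ → ℝ) : ℕ → ℕ → ℝ → ℝ
  | 0, i, x =>
      open Classical in
      if (t i ≤ x ∧ x < t (i + 1)) ∨ (t i < t (i + 1) ∧ t (i + 1) = 1 ∧ x = 1) then 1 else 0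
  | p + 1, i, x =>
      (x - t i) / (t (i + p + 1) - t i) * coxDeBoor t p i x
        + (t (i + p + 2) - x) / (t (i + p + 2) - t (i + 1)) * coxDeBoor t p (i + 1) x

/-- The B-spline `N_j^{p,r}` on `[0,1]`, for `j = 0, …, n_{p,r} - 1`. -/
def bspline (p r k j : ℕ) : I01 → ℝ := fun x => coxDeBoor (knot p r k) p j x

/-- `μ` are coefficients of `N_i^{p₁,r₁}` with respect to the B-splines `N_j^{p₂,r₂}`. -/
def IsRepresentation (p₁ r₁ p₂ r₂ k i : ℕ) (μ : Fin (numBSplines p₂ r₂ k) → ℝ) : Prop :=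
  bspline p₁ r₁ k i = ∑ j, μ j • bspline p₂ r₂ k j

/-- The coefficients `μ_j^{(i)}` of `N_i^{p₁,r₁}` with respect to the B-splines `N_j^{p₂,r₂}`. -/
def coeff (p₁ r₁ p₂ r₂ k i : ℕ) : Fin (numBSplines p₂ r₂ k) → ℝ :=
  Classical.epsilon (IsRepresentation p₁ r₁ p₂ r₂ k i)

/-- The truncated B-spline: the sum of `μ_j^{(i)} N_j^{p₂,r₂}` over
`j = s + 1, …, n_{p₂,r₂} - s - 2`. -/
def truncBSpline (s p₁ r₁ p₂ r₂ k i : ℕ) : I01 → ℝ :=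
  ∑ j ∈ univ.filter (fun j : Fin (numBSplines p₂ r₂ k) =>
      s + 1 ≤ (j : ℕ) ∧ (j : ℕ) ≤ numBSplines p₂ r₂ k - s - 2),
    coeff p₁ r₁ p₂ r₂ k i j • bspline p₂ r₂ k j

/-- The tensor product `(x, y) ↦ f x * g y` on the unit square. -/
def tensor (f g : I01 → ℝ) : I01 × I01 → ℝ := fun z => f z.1 * g z.2

/-- Tensor-product B-spline `N_{j₁,j₂}^{p,r}`. -/
def bspline₂ (p r k : ℕ) (j : ℕ × ℕ) : I01 × I01 → ℝ :=
  tensor (bspline p r k j.1) (bspline p r k j.2)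

/-- Tensor-product truncated B-spline. -/
def truncBSpline₂ (s p₁ r₁ p₂ r₂ k : ℕ) (j : ℕ × ℕ) : I01 × I01 → ℝ :=
  tensor (truncBSpline s p₁ r₁ p₂ r₂ k j.1) (truncBSpline s p₁ r₁ p₂ r₂ k j.2)

/-- Index pairs of the B-splines spanning `S₁`; here and in the next two, `n = n_{p₁,r₁}`. -/
def idxS₁ (s n : ℕ) : Finset (ℕ × ℕ) := Icc (s + 1) (n - s - 2) ×ˢ Icc (s + 1) (n - s - 2)

/-- Index pairs of the first part of the truncated B-splines. -/
def idxS₁barA (s n : ℕ) : Finset (ℕ × ℕ) :=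
  (Icc 1 s ∪ Icc (n - s - 1) (n - 2)) ×ˢ Icc 1 (n - 2)

/-- Index pairs of the second part of the truncated B-splines. -/
def idxS₁barB (s n : ℕ) : Finset (ℕ × ℕ) :=
  Icc (s + 1) (n - s - 2) ×ˢ (Icc 1 s ∪ Icc (n - s - 1) (n - 2))

/-- Index pairs of the first part of the B-splines spanning `S₂`; here and in the next one,
`n = n_{p₂,r₂}`. -/
def idxS₂A (s n : ℕ) : Finset (ℕ × ℕ) :=
  (Icc 0 s ∪ Icc (n - s - 1) (n - 1)) ×ˢ Icc 0 (n - 1)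

/-- Index pairs of the second part of the B-splines spanning `S₂`. -/
def idxS₂B (s n : ℕ) : Finset (ℕ × ℕ) :=
  Icc (s + 1) (n - s - 2) ×ˢ (Icc 0 s ∪ Icc (n - s - 1) (n - 1))

/-- The space `S₁([0,1]²)`. -/
def S₁ (s p₁ r₁ k : ℕ) : Submodule ℝ (I01 × I01 → ℝ) :=
  Submodule.span ℝ (bspline₂ p₁ r₁ k '' idxS₁ s (numBSplines p₁ r₁ k))

/-- First summand of the space spanned by truncated B-splines. -/
def S₁barA (s p₁ r₁ p₂ r₂ k : ℕ) : Submodule ℝ (I01 × I01 → ℝ) :=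
  Submodule.span ℝ (truncBSpline₂ s p₁ r₁ p₂ r₂ k '' idxS₁barA s (numBSplines p₁ r₁ k))

/-- Second summand of the space spanned by truncated B-splines. -/
def S₁barB (s p₁ r₁ p₂ r₂ k : ℕ) : Submodule ℝ (I01 × I01 → ℝ) :=
  Submodule.span ℝ (truncBSpline₂ s p₁ r₁ p₂ r₂ k '' idxS₁barB s (numBSplines p₁ r₁ k))

/-- The space spanned by the truncated B-splines. -/
def S₁bar (s p₁ r₁ p₂ r₂ k : ℕ) : Submodule ℝ (I01 × I01 → ℝ) :=
  S₁barA s p₁ r₁ p₂ r₂ k ⊔ S₁barB s p₁ r₁ p₂ r₂ k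

/-- First summand of `S₂([0,1]²)`. -/
def S₂A (s p₂ r₂ k : ℕ) : Submodule ℝ (I01 × I01 → ℝ) :=
  Submodule.span ℝ (bspline₂ p₂ r₂ k '' idxS₂A s (numBSplines p₂ r₂ k))

/-- Second summand of `S₂([0,1]²)`. -/
def S₂B (s p₂ r₂ k : ℕ) : Submodule ℝ (I01 × I01 → ℝ) :=
  Submodule.span ℝ (bspline₂ p₂ r₂ k '' idxS₂B s (numBSplines p₂ r₂ k))

/-- The space `S₂([0,1]²)`. -/
def S₂ (s p₂ r₂ k : ℕ) : Submodule ℝ (I01 × I01 → ℝ) :=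
  S₂A s p₂ r₂ k ⊔ S₂B s p₂ r₂ k

/-- The mixed degree and regularity spline space on `[0,1]²`. -/
def mixedSpace (s p₁ r₁ p₂ r₂ k : ℕ) : Submodule ℝ (I01 × I01 → ℝ) :=
  S₁ s p₁ r₁ k ⊔ S₁bar s p₁ r₁ p₂ r₂ k ⊔ S₂ s p₂ r₂ k

/-- Index type of all basis functions of the three subspaces together (a disjoint union). -/
abbrev BasisIdx (s p₁ r₁ p₂ r₂ k : ℕ) : Type :=
  idxS₁ s (numBSplines p₁ r₁ k)
    ⊕ (idxS₁barA s (numBSplines p₁ r₁ k) ⊕ idxS₁barB s (numBSplines p₁ r₁ k))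
    ⊕ (idxS₂A s (numBSplines p₂ r₂ k) ⊕ idxS₂B s (numBSplines p₂ r₂ k))

/-- The family of all basis functions of the three subspaces together. -/
def basisFun (s p₁ r₁ p₂ r₂ k : ℕ) : BasisIdx s p₁ r₁ p₂ r₂ k → (I01 × I01 → ℝ)
  | .inl j => bspline₂ p₁ r₁ k j
  | .inr (.inl (.inl j)) => truncBSpline₂ s p₁ r₁ p₂ r₂ k j
  | .inr (.inl (.inr j)) => truncBSpline₂ s p₁ r₁ p₂ r₂ k j
  | .inr (.inr (.inl j)) => bspline₂ p₂ r₂ k j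
  | .inr (.inr (.inr j)) => bspline₂ p₂ r₂ k j

end MixedSpline

end

open MixedSpline

namespace MixedSpline

open Polynomial Submodule

/-! ### Cox-de Boor recursion and Marsden's identity -/

section CoxDeBoor

variable {t : ℕ → ℝ}

/-! The substance is univariate; call the splines of degree p₂ "fine". For i in M₁ the B-spline N_i
vanishes to order s + 1 at both ends, so it does not involve the s + 1 outermost fine B-splines at
either end, and truncation leaves it unchanged (`truncBSpline_eq_bspline`). Hence the functions of
S₁ and S̄₁ are all products of truncated B-splines with indices 1, …, n₁ - 2. They lie in the span
of the fine products with both indices in M₂, while S₂ uses the other fine products. What remains is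
independence of the univariate truncated family (`linearIndepOn_truncBSpline`).

If Σ cᵢ N̄ᵢ = 0, then f = Σ cᵢ Nᵢ is a combination of outer fine B-splines, which live on the first
and last knot intervals. So f vanishes in between, and k ≥ 2 makes this contain the second interval.
By smoothness f is a multiple of (x - 1/(k+1))^p₁ on the first interval, and f(0) = 0 kills it
(`eq_zero_of_vanishes`). Reflection settles the other end.

The B-spline facts come from `marsden`: its Taylor coefficients at a breakpoint express truncated
powers through B-splines, and a dimension count (`span_image_eq_of_card_le`) then gives independence
as well as the spans of B-splines with prescribed vanishing at an end. Inclusions of spline spaces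
become inclusions of sets of truncated powers. -/

/-- A B-spline vanishes to the left of its first knot. -/
theorem coxDeBoor_eq_zero_of_lt (ht : Monotone t) (h1 : ∀ i, t i ≤ 1) (p : ℕ) :
    ∀ {i : ℕ} {x : ℝ}, x < t i → coxDeBoor t p i x = 0 := by
  induction p with
  | zero =>
    intro i x hx
    have := h1 i
    rw [coxDeBoor, if_neg]
    rintro (⟨h, -⟩ | ⟨h, h', h''⟩) <;> linarith
  | succ p ih =>
    intro i x hx
    rw [coxDeBoor, ih hx, ih (hx.trans_le (ht (Nat.le_succ i)))]
    simp

/-- A B-spline vanishes to the right of its last knot, if that is not `1`. -/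
theorem coxDeBoor_eq_zero_of_le (ht : Monotone t) (p : ℕ) :
    ∀ {i : ℕ} {x : ℝ}, t (i + p + 1) ≤ x → t (i + p + 1) < 1 → coxDeBoor t p i x = 0 := by
  induction p with
  | zero =>
    intro i x hx h1
    rw [coxDeBoor, if_neg]
    simp only [add_zero] at hx h1
    rintro (⟨h, h'⟩ | ⟨h, h', h''⟩) <;> linarith
  | succ p ih =>
    intro i x hx h1
    have h := ht (show i + p + 1 ≤ i + (p + 1) + 1 by omega)
    rw [coxDeBoor, ih (h.trans hx) (h.trans_lt h1), ih (i := i + 1)]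
    · simp
    · rwa [show i + 1 + p + 1 = i + (p + 1) + 1 by omega]
    · rwa [show i + 1 + p + 1 = i + (p + 1) + 1 by omega]

/-- A B-spline with coinciding knots vanishes. -/
theorem coxDeBoor_eq_zero_of_eq (ht : Monotone t) (p : ℕ) :
    ∀ {i : ℕ} {x : ℝ}, t (i + p + 1) = t i → coxDeBoor t p i x = 0 := by
  induction p with
  | zero =>
    intro i x hx
    rw [coxDeBoor, if_neg]
    simp only [add_zero] at hx
    rintro (⟨h, h'⟩ | ⟨h, h', h''⟩) <;> linarith
  | succ p ih =>
    intro i x hx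
    have h1 := ht (show i ≤ i + 1 by omega)
    have h2 := ht (show i + p + 1 ≤ i + (p + 1) + 1 by omega)
    have h3 := ht (show i + 1 ≤ i + p + 1 by omega)
    rw [coxDeBoor, ih (i := i), ih (i := i + 1)]
    · simp
    · rw [show i + 1 + p + 1 = i + (p + 1) + 1 by omega]; linarith
    · linarith

/-- The dual polynomials of Marsden's identity. -/
noncomputable def dualPoly (t : ℕ → ℝ) (p i : ℕ) : ℝ[X] :=
  ∏ l ∈ range p, (X - C (t (i + 1 + l)))

theorem sum_coxDeBoor_zero (ht : Monotone t) {n : ℕ} {x : ℝ} (h0 : t 0 = 0)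
    (hn : ∀ i, n ≤ i → t i = 1) (hx0 : 0 ≤ x) (hx1 : x ≤ 1) :
    ∑ i ∈ range n, coxDeBoor t 0 i x = 1 := by
  classical
  have hle : ∀ i, t i ≤ 1 := fun i =>
    (ht (le_max_left i n)).trans (hn _ (le_max_right i n)).le
  rcases hx1.lt_or_eq with hx | rfl
  -- Writing each indicator as a difference of step functions in the knot makes the sum telescope.
  · have : ∀ i ∈ range n, coxDeBoor t 0 i x =
        (if x < t (i + 1) then (1 : ℝ) else 0) - (if x < t i then 1 else 0) := by
      intro i _
      have h := ht (Nat.le_succ i)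
      simp only [Nat.succ_eq_add_one] at h
      rw [coxDeBoor]
      by_cases h1 : x < t i
      · have h2 : x < t (i + 1) := by linarith
        simp [h1, h2, not_le.2 h1, hx.ne]
      · by_cases h2 : x < t (i + 1)
        · simp [h1, h2, not_lt.1 h1]
        · simp [h1, h2, hx.ne]
    rw [sum_congr rfl this, sum_range_sub (fun i => if x < t i then (1 : ℝ) else 0)]
    simp [hn n le_rfl, hx, h0, hx0]
  -- At x = 1 the closed last interval counts, so the step function becomes the test `t i = 1`.
  · have : ∀ i ∈ range n, coxDeBoor t 0 i 1 =
        (if t (i + 1) = 1 then (1 : ℝ) else 0) - (if t i = 1 then 1 else 0) := by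
      intro i _
      have h := ht (Nat.le_succ i)
      simp only [Nat.succ_eq_add_one] at h
      rw [coxDeBoor]
      by_cases h1 : t i = 1
      · have h2 : t (i + 1) = 1 := le_antisymm (hle _) (h1 ▸ h)
        simp [h1, h2]
      · have h1' := lt_of_le_of_ne (hle i) h1
        by_cases h2 : t (i + 1) = 1
        · simp [h1, h2, h1']
        · simp [h1, h2, not_lt.2 (hle (i + 1))]
    rw [sum_congr rfl this, sum_range_sub (fun i => if t i = 1 then (1 : ℝ) else 0)]
    simp [hn n le_rfl, h0]

/-- **Marsden's identity**. -/
theorem marsden (ht : Monotone t) {n p : ℕ} {x : ℝ} (h0 : ∀ i ≤ p, t i = 0)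
    (hn : ∀ i, n ≤ i → t i = 1) (hx0 : 0 ≤ x) (hx1 : x ≤ 1) :
    ∑ i ∈ range n, C (coxDeBoor t p i x) * dualPoly t p i = (X - C x) ^ p := by
  -- The knots stay fixed while the degree grows; the `p + 1` zero knots are more than lower degrees
  -- need.
  suffices H : ∀ q ≤ p, ∑ i ∈ range n, C (coxDeBoor t q i x) * dualPoly t q i = (X - C x) ^ q from
    H p le_rfl
  intro q
  induction q with
  | zero =>
    intro _
    simp only [dualPoly, range_zero, prod_empty, mul_one, pow_zero]
    rw [← map_sum, sum_coxDeBoor_zero ht (h0 0 (Nat.zero_le _)) hn hx0 hx1, C_1]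
  | succ q ih =>
    intro hq
    -- Chosen so that the second Cox-de Boor term is `f (i + 1)` and the first one is the degree-`q`
    -- term times X - x, minus `f i`.
    set f : ℕ → ℝ[X] := fun i =>
      C ((t (i + q + 1) - x) / (t (i + q + 1) - t i) * coxDeBoor t q i x) *
        ((X - C (t i)) * dualPoly t q i) with hf
    have key : ∀ i ∈ range n, C (coxDeBoor t (q + 1) i x) * dualPoly t (q + 1) i =
        C (coxDeBoor t q i x) * dualPoly t q i * (X - C x) + (f (i + 1) - f i) := by
      intro i _
      have e1 : dualPoly t (q + 1) i = dualPoly t q i * (X - C (t (i + q + 1))) := by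
        rw [dualPoly, prod_range_succ, dualPoly, show i + 1 + q = i + q + 1 by omega]
      have e2 : dualPoly t (q + 1) i = (X - C (t (i + 1))) * dualPoly t q (i + 1) := by
        rw [dualPoly, prod_range_succ', dualPoly, mul_comm]
        simp only [add_zero]
        congr 1
        refine prod_congr rfl fun l _ => ?_
        rw [show i + 1 + (l + 1) = i + 1 + 1 + l by omega]
      have e3 : f (i + 1) = C ((t (i + q + 2) - x) / (t (i + q + 2) - t (i + 1)) *
          coxDeBoor t q (i + 1) x) * dualPoly t (q + 1) i := by
        rw [e2, hf]
        simp only [show i + 1 + q + 1 = i + q + 2 by omega]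
      rw [e3, coxDeBoor, C_add, add_mul, e1, hf]
      simp only
      by_cases h : t (i + q + 1) - t i = 0
      · rw [coxDeBoor_eq_zero_of_eq ht q (i := i) (by linarith)]
        simp
      · have h1 : (x - t i) / (t (i + q + 1) - t i) =
            1 - (t (i + q + 1) - x) / (t (i + q + 1) - t i) := by field_simp; ring
        have h2 : C ((t (i + q + 1) - x) / (t (i + q + 1) - t i)) * (C (t (i + q + 1)) - C (t i)) =
            C (t (i + q + 1)) - C x := by
          rw [← C_sub, ← C_sub, ← C_mul]; congr 1; field_simp
        rw [h1]
        simp only [C_mul, C_sub, C_1]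
        linear_combination (C (coxDeBoor t q i x) * dualPoly t q i) * h2
    -- The telescoping ends vanish because all knots of the B-splines `0` and `n` coincide.
    have f0 : f 0 = 0 := by
      rw [hf]; simp only
      rw [coxDeBoor_eq_zero_of_eq ht q (i := 0)]
      · simp
      · rw [h0 _ (by omega), h0 _ (by omega)]
    have fn : f n = 0 := by
      rw [hf]; simp only
      rw [coxDeBoor_eq_zero_of_eq ht q (i := n)]
      · simp
      · rw [hn _ (by omega), hn _ (by omega)]
    rw [sum_congr rfl key, sum_add_distrib, sum_range_sub, f0, fn, ← sum_mul, ih (by omega)]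
    ring

/-- Marsden's identity, Taylor-expanded at `τ`. -/
theorem marsden_coeff (ht : Monotone t) {n p : ℕ} {x : ℝ} (h0 : ∀ i ≤ p, t i = 0)
    (hn : ∀ i, n ≤ i → t i = 1) (hx0 : 0 ≤ x) (hx1 : x ≤ 1) (τ : ℝ) (ν : ℕ) :
    ∑ i ∈ range n, (taylor τ (dualPoly t p i)).coeff ν * coxDeBoor t p i x =
      (τ - x) ^ (p - ν) * p.choose ν := by
  have h := congrArg (fun P => (taylor τ P).coeff ν) (marsden ht h0 hn hx0 hx1)
  simp only [map_sum, finsetSum_coeff, taylor_mul, taylor_C, coeff_C_mul] at h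
  rw [sum_congr rfl fun i _ => mul_comm _ _, h]
  have : taylor τ ((X - C x) ^ p) = (X + C (τ - x)) ^ p := by
    rw [← taylorAlgHom_apply, map_pow, map_sub, taylorAlgHom_apply, taylorAlgHom_apply, taylor_X,
      taylor_C, C_sub]
    ring
  rw [this, coeff_X_add_C_pow]

/-- The roots of the dual polynomial are the knots i + 1, …, i + p; a block of μ knots equal to τ
among them is a root of multiplicity μ. -/
theorem coeff_taylor_dualPoly_eq_zero {p i b μ ν : ℕ} {τ : ℝ}
    (hτ : ∀ j, b ≤ j → j < b + μ → t j = τ) (h1 : i + 1 ≤ b) (h2 : b + μ ≤ i + 1 + p)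
    (hν : ν < μ) : (taylor τ (dualPoly t p i)).coeff ν = 0 := by
  have hd : (X - C τ) ^ μ ∣ dualPoly t p i := by
    have : (X - C τ) ^ μ = ∏ l ∈ Ico (b - (i + 1)) (b - (i + 1) + μ), (X - C (t (i + 1 + l))) := by
      rw [prod_congr rfl (g := fun _ => X - C τ), prod_const, Nat.card_Ico]
      · congr 1; omega
      · intro l hl
        rw [mem_Ico] at hl
        rw [hτ _ (by omega) (by omega)]
    rw [this, dualPoly]
    apply prod_dvd_prod_of_subset
    intro l hl
    rw [mem_Ico] at hl
    rw [mem_range]; omega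
  obtain ⟨Q, hQ⟩ := hd
  have : taylor τ (dualPoly t p i) = X ^ μ * taylor τ Q := by
    rw [hQ, taylor_mul, ← taylorAlgHom_apply, map_pow, map_sub, taylorAlgHom_apply,
      taylorAlgHom_apply, taylor_X, taylor_C, add_sub_cancel_right]
  exact X_pow_dvd_iff.1 ⟨_, this⟩ ν hν

end CoxDeBoor

/-! ### Explicit knot positions and supports -/

section Knots

/-- The knots are `knotNum / (k + 1)`. -/
def knotNum (p r k i : ℕ) : ℕ := min ((i + (p - r) - (p + 1)) / (p - r)) (k + 1)

variable {p r k : ℕ}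

theorem knot_eq (h : r < p) (i : ℕ) : knot p r k i = (knotNum p r k i : ℝ) / ((k : ℝ) + 1) := by
  obtain ⟨d, rfl⟩ : ∃ d, p = r + (d + 1) := ⟨p - r - 1, by omega⟩
  unfold knot knotNum numBSplines
  rw [show r + (d + 1) - r = d + 1 by omega]
  split_ifs with h1 h2
  · rw [Nat.div_eq_of_lt (by omega)]; simp
  · rw [show i + (d + 1) - (r + (d + 1) + 1) = i - (r + (d + 1) + 1) + (d + 1) by omega,
      Nat.add_div_right _ (by omega), min_eq_left]
    rw [Nat.succ_le_succ_iff]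
    have := Nat.div_lt_of_lt_mul (k := k) (show i - (r + (d + 1) + 1) < (d + 1) * k by
      rw [mul_comm]; omega)
    exact this.le
  · rw [min_eq_right]
    · push_cast; field_simp
    · rw [Nat.le_div_iff_mul_le (by omega), add_mul]; omega

theorem le_knotNum (h : r < p) {m i : ℕ} (hm : m ≤ k) (hi : p + 1 + m * (p - r) ≤ i) :
    m + 1 ≤ knotNum p r k i := by
  unfold knotNum
  rw [le_min_iff, Nat.le_div_iff_mul_le (by omega), add_mul]
  omega

theorem knotNum_le (h : r < p) {m i : ℕ} (hi : i < p + 1 + m * (p - r)) :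
    knotNum p r k i ≤ m := by
  unfold knotNum
  refine (min_le_left _ _).trans (Nat.le_of_lt_succ ?_)
  rw [Nat.div_lt_iff_lt_mul (by omega), Nat.succ_mul]
  omega

theorem knotNum_eq_zero (h : r < p) {i : ℕ} (hi : i ≤ p) : knotNum p r k i = 0 :=
  Nat.le_zero.1 (knotNum_le h (by omega))

theorem knotNum_eq_last (h : r < p) {i : ℕ} (hi : numBSplines p r k ≤ i) :
    knotNum p r k i = k + 1 :=
  le_antisymm (min_le_right _ _) (le_knotNum h le_rfl hi)

theorem knot_monotone (h : r < p) : Monotone (knot p r k) := by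
  intro i j hij
  rw [knot_eq h, knot_eq h]
  have : knotNum p r k i ≤ knotNum p r k j :=
    min_le_min_right _ (Nat.div_le_div_right (by omega))
  gcongr

theorem knot_eq_zero (h : r < p) {i : ℕ} (hi : i ≤ p) : knot p r k i = 0 := by
  rw [knot_eq h, knotNum_eq_zero h hi]; simp

theorem knot_eq_one (h : r < p) {i : ℕ} (hi : numBSplines p r k ≤ i) : knot p r k i = 1 := by
  rw [knot_eq h, knotNum_eq_last h hi]; push_cast; field_simp

theorem knot_le_one (h : r < p) (i : ℕ) : knot p r k i ≤ 1 := by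
  rw [knot_eq h, div_le_one (by positivity)]
  exact_mod_cast min_le_right _ _

theorem le_knot (h : r < p) {m i : ℕ} (hm : m ≤ knotNum p r k i) :
    (m : ℝ) / (k + 1) ≤ knot p r k i := by
  rw [knot_eq h]; gcongr

theorem knot_le (h : r < p) {m i : ℕ} (hm : knotNum p r k i ≤ m) :
    knot p r k i ≤ (m : ℝ) / (k + 1) := by
  rw [knot_eq h]; gcongr

theorem bspline_eq_zero_of_lt (h : r < p) {m j : ℕ} (hm : m ≤ knotNum p r k j) {x : I01}
    (hx : (x : ℝ) < m / (k + 1)) : bspline p r k j x = 0 :=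
  coxDeBoor_eq_zero_of_lt (knot_monotone h) (knot_le_one h) _ (hx.trans_le (le_knot h hm))

theorem bspline_eq_zero_of_le (h : r < p) {m j : ℕ} (hm : knotNum p r k (j + p + 1) ≤ m)
    (hmk : m ≤ k) {x : I01} (hx : (m : ℝ) / (k + 1) ≤ x) : bspline p r k j x = 0 := by
  have h1 := knot_le h hm
  refine coxDeBoor_eq_zero_of_le (knot_monotone h) _ (h1.trans hx) (h1.trans_lt ?_)
  rw [div_lt_one (by positivity)]
  exact_mod_cast Nat.lt_succ_of_le hmk

theorem bspline_marsden (h : r < p) (x : I01) (τ : ℝ) (ν : ℕ) :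
    ∑ i ∈ range (numBSplines p r k), (taylor τ (dualPoly (knot p r k) p i)).coeff ν *
      bspline p r k i x = (τ - x) ^ (p - ν) * p.choose ν :=
  marsden_coeff (knot_monotone h) (fun _ hi => knot_eq_zero h hi)
    (fun _ hi => knot_eq_one h hi) x.2.1 x.2.2 τ ν

end Knots

/-! ### Truncated powers and their mirror images -/

section TruncatedPowers

/-- The truncated power `(x - m / (k + 1))₊ ^ l`, indexed by `(m, l)`. -/
noncomputable def truncPow (k : ℕ) (i : ℕ × ℕ) : I01 → ℝ := fun x =>
  if (x : ℝ) < i.1 / ((k : ℝ) + 1) then 0 else ((x : ℝ) - i.1 / ((k : ℝ) + 1)) ^ i.2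

/-- The truncated powers are linearly independent. -/
theorem linearIndepOn_truncPow (k : ℕ) : LinearIndepOn ℝ (truncPow k) {i | i.1 ≤ k} := by
  rw [linearIndepOn_iff']
  intro t g ht hg
  have hk : (0 : ℝ) < (k : ℝ) + 1 := by positivity
  suffices H : ∀ m l, (m, l) ∈ t → g (m, l) = 0 from fun i hi => H i.1 i.2 hi
  intro m
  induction m using Nat.strong_induction_on with
  | _ m ih =>
    intro l hl
    have hmk : m ≤ k := ht hl
    -- Just to the right of breakpoint `m`, later truncated powers are zero and earlier coefficients
    -- vanish by induction, so only this polynomial in the distance to the breakpoint survives.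
    set P : ℝ[X] := ∑ i ∈ t.filter (fun i => i.1 = m), C (g i) * X ^ i.2 with hP
    have hroot : Set.Ioo (0 : ℝ) (1 / (k + 1)) ⊆ {y | P.IsRoot y} := by
      intro y hy
      have hm0 : (0 : ℝ) ≤ m / ((k : ℝ) + 1) := by positivity
      have hm1 : (m : ℝ) / (k + 1) + y < ((m + 1 : ℕ) : ℝ) / (k + 1) := by
        push_cast; rw [add_div]; linarith [hy.2]
      have hm2 : ((m + 1 : ℕ) : ℝ) / (k + 1) ≤ 1 := by
        rw [div_le_one hk]; exact_mod_cast Nat.succ_le_succ hmk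
      have h := congrFun hg ⟨(m : ℝ) / (k + 1) + y, by linarith [hy.1], by linarith⟩
      simp only [Finset.sum_apply, Pi.smul_apply, smul_eq_mul, Pi.zero_apply] at h
      simp only [Set.mem_ofPred_eq, IsRoot, hP, eval_finsetSum, eval_mul, eval_C, eval_pow, eval_X]
      rw [sum_filter]
      refine Eq.trans (sum_congr rfl fun i hi => ?_) h
      rcases lt_trichotomy i.1 m with him | him | him
      · rw [if_neg him.ne, ih i.1 him i.2 hi, zero_mul]
      · rw [if_pos him, truncPow, him, if_neg (by simp [hy.1.le]), add_sub_cancel_left]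
      · rw [if_neg him.ne', truncPow, if_pos, mul_zero]
        refine hm1.trans_le ?_
        gcongr; exact_mod_cast him
    have hP0 : P = 0 := eq_zero_of_infinite_isRoot P
      ((Set.Ioo_infinite (by positivity)).mono hroot)
    have hc := congrArg (fun Q => Q.coeff l) hP0
    simp only [hP, finsetSum_coeff, coeff_C_mul, coeff_X_pow, coeff_zero] at hc
    rw [sum_eq_single (m, l)] at hc
    · simpa using hc
    · rintro ⟨m', l'⟩ hi hne
      rw [mem_filter] at hi
      obtain ⟨_, rfl⟩ := hi
      rw [if_neg, mul_zero]
      rintro rfl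
      exact hne rfl
    · intro h
      exact absurd (by simp [hl]) h

/-- The truncated powers `x ^ l`, `q ≤ l ≤ p`, and `(x - m / (k + 1))₊ ^ l`, `r < l ≤ p`. -/
def truncPowIdx (p r k q : ℕ) : Finset (ℕ × ℕ) :=
  ({0} ×ˢ Icc q p) ∪ (Icc 1 k ×ˢ Icc (r + 1) p)

theorem mem_truncPowIdx {p r k q m l : ℕ} : (m, l) ∈ truncPowIdx p r k q ↔
    (m = 0 ∧ q ≤ l ∧ l ≤ p) ∨ (1 ≤ m ∧ m ≤ k ∧ r + 1 ≤ l ∧ l ≤ p) := by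
  simp only [truncPowIdx, mem_union, mem_product, mem_singleton, mem_Icc]
  tauto

theorem card_truncPowIdx {p r k q : ℕ} (hq : q ≤ p + 1) :
    (truncPowIdx p r k q).card = numBSplines p r k - q := by
  rw [truncPowIdx, card_union_of_disjoint, card_product, card_product, numBSplines]
  · simp only [card_singleton, Nat.card_Icc, Nat.add_sub_cancel, Nat.add_sub_add_right]
    omega
  · rw [disjoint_left]
    rintro ⟨m, l⟩ h1 h2
    simp only [mem_product, mem_singleton, mem_Icc] at h1 h2
    omega

theorem coe_truncPowIdx_subset (p r k q : ℕ) :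
    (truncPowIdx p r k q : Set (ℕ × ℕ)) ⊆ {i | i.1 ≤ k} := by
  rintro ⟨m, l⟩ h
  rw [mem_coe, mem_truncPowIdx] at h
  simp only [Set.mem_ofPred_eq]; omega

theorem truncPowIdx_subset {p₁ p₂ r₁ r₂ k q : ℕ} (hp : p₁ ≤ p₂) (hr : r₂ ≤ r₁) :
    truncPowIdx p₁ r₁ k q ⊆ truncPowIdx p₂ r₂ k q := by
  rintro ⟨m, l⟩ h
  rw [mem_truncPowIdx] at h ⊢
  omega

/-- The truncated powers mirrored at `1 / 2`. -/
noncomputable def truncPowSymm (k : ℕ) (i : ℕ × ℕ) : I01 → ℝ := truncPow k i ∘ unitInterval.symm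

theorem linearIndepOn_truncPowSymm (k : ℕ) : LinearIndepOn ℝ (truncPowSymm k) {i | i.1 ≤ k} := by
  have h := (linearIndepOn_truncPow k).map' (LinearMap.funLeft ℝ ℝ unitInterval.symm)
    (LinearMap.ker_eq_bot.2 (LinearMap.funLeft_injective_of_surjective _ _ _
      unitInterval.symm_bijective.surjective))
  exact h

end TruncatedPowers

/-! ### Equality of spans by dimension -/

section SpanByDimension

/-- The independent family gives a lower bound for the dimension and the number of generators an
upper one; when they meet, spanning and independence follow at once. -/
theorem span_image_eq_of_card_le {ι κ M : Type*} [AddCommGroup M] [Module ℝ M] {v : ι → M}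
    {w : κ → M} {J : Finset ι} {T : Finset κ} (hw : LinearIndepOn ℝ w (T : Set κ))
    (hT : ∀ i ∈ T, w i ∈ span ℝ (v '' J)) (hc : J.card ≤ T.card) :
    span ℝ (v '' J) = span ℝ (w '' T) ∧ LinearIndepOn ℝ v (J : Set ι) := by
  have h1 : span ℝ (w '' T) ≤ span ℝ (v '' J) := by
    rw [span_le]; rintro _ ⟨i, hi, rfl⟩; exact hT i hi
  have h2 : Module.finrank ℝ (span ℝ (w '' T)) = T.card := by
    have := finrank_span_eq_card (R := ℝ) (b := fun i : (T : Set κ) => w i) hw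
    rw [Set.image_eq_range, this]; simp
  have : FiniteDimensional ℝ (span ℝ (v '' J)) :=
    FiniteDimensional.span_of_finite ℝ (J.finite_toSet.image v)
  have h3 : Module.finrank ℝ (span ℝ (v '' J)) ≤ J.card := by
    have := finrank_range_le_card (R := ℝ) (fun i : (J : Set ι) => v i)
    rw [Set.finrank, ← Set.image_eq_range] at this
    simpa using this
  have h4 := Submodule.finrank_mono h1
  refine ⟨(eq_of_le_of_finrank_eq h1 (by omega)).symm, ?_⟩
  change LinearIndependent ℝ fun i : (J : Set ι) => v i
  rw [linearIndependent_iff_card_eq_finrank_span, Set.finrank, ← Set.image_eq_range]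
  simp only [Finset.coe_sort_coe, Fintype.card_coe]
  omega

theorem sum_mul_mem_span {J : Finset ℕ} {v : ℕ → I01 → ℝ} {f : I01 → ℝ} {c : ℕ → ℝ} {e : ℝ}
    (he : e ≠ 0) (h : ∀ x, ∑ i ∈ J, c i * v i x = e * f x) : f ∈ span ℝ (v '' J) := by
  have : f = e⁻¹ • ∑ i ∈ J, c i • v i := by
    ext x
    simp only [Pi.smul_apply, Finset.sum_apply, smul_eq_mul, h x]
    field_simp
  rw [this]
  exact smul_mem _ _ (sum_mem fun i hi => smul_mem _ _ (subset_span ⟨i, hi, rfl⟩))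

end SpanByDimension

/-! ### Spline spaces spanned by truncated powers -/

section SplineSpace

variable {p r k : ℕ}

/-- Marsden's identity gives the full power (τ - x)^l at τ = m/(k+1); dropping the terms with index
below `a` truncates it. To the right of τ the dropped terms are zero anyway, and to the left the
kept ones are. -/
theorem truncPow_mem_span (h : r < p) {q m l : ℕ} (hq : q ≤ p + 1)
    (hi : (m, l) ∈ truncPowIdx p r k q) :
    truncPow k (m, l) ∈ span ℝ (bspline p r k '' Ico q (numBSplines p r k)) := by
  rw [mem_truncPowIdx] at hi
  have hlp : l ≤ p := by omega
  set n := numBSplines p r k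
  set c : ℕ → ℝ := fun i =>
    (taylor ((m : ℝ) / (k + 1)) (dualPoly (knot p r k) p i)).coeff (p - l) with hcdef
  have hc : ∀ i, c i = (taylor ((m : ℝ) / (k + 1)) (dualPoly (knot p r k) p i)).coeff (p - l) :=
    fun _ => rfl
  -- For m > 0 this is the index of the first copy of the knot m/(k+1).
  set a := if m = 0 then q else p + 1 + (m - 1) * (p - r) with ha
  have hqa : q ≤ a := by rw [ha]; split_ifs <;> omega
  suffices H : truncPow k (m, l) ∈ span ℝ (bspline p r k '' Ico a n) from
    span_mono (Set.image_mono (by exact_mod_cast Ico_subset_Ico_left hqa)) H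
  have hzero : ∀ x : I01, (m : ℝ) / (k + 1) ≤ x → ∀ j < a, c j * bspline p r k j x = 0 := by
    intro x hx j hj
    by_cases hm : m = 0
    · rw [if_pos hm] at ha
      rw [hc, coeff_taylor_dualPoly_eq_zero (b := j + 1) (μ := p - j), zero_mul]
      · intro i _ hi2
        rw [knot_eq_zero h (by omega), hm]; simp
      · omega
      · omega
      · omega
    · rw [if_neg hm] at ha
      have e : p + 1 + m * (p - r) = a + (p - r) := by
        rw [ha]; conv_lhs => rw [show m = m - 1 + 1 by omega, Nat.succ_mul]
        omega
      -- Either all p - r copies of τ are interior knots of the B-spline, and the coefficient of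
      -- order p - l < p - r vanishes, or its support ends no later than τ.
      by_cases hj' : a + (p - r) ≤ j + 1 + p
      · rw [hc, coeff_taylor_dualPoly_eq_zero (b := a) (μ := p - r), zero_mul]
        · intro i hi1 hi2
          rw [knot_eq h, le_antisymm (knotNum_le h (m := m) (by omega))
            (show m ≤ _ by
              have := le_knotNum h (m := m - 1) (i := i) (k := k) (by omega) (by omega)
              omega)]
        · omega
        · omega
        · omega
      · rw [bspline_eq_zero_of_le h (m := m) (knotNum_le h (by omega)) (by omega) hx, mul_zero]
  refine sum_mul_mem_span (c := c) (e := (-1) ^ l * p.choose (p - l)) ?_ fun x => ?_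
  · have := Nat.choose_pos (show p - l ≤ p by omega)
    have h2 : (p.choose (p - l) : ℝ) ≠ 0 := by exact_mod_cast this.ne'
    exact mul_ne_zero (pow_ne_zero _ (by norm_num)) h2
  · by_cases hx : (x : ℝ) < m / (k + 1)
    · rw [truncPow, if_pos hx, mul_zero]
      refine sum_eq_zero fun j hj => ?_
      rw [mem_Ico] at hj
      have hm : m ≠ 0 := by
        rintro rfl
        simp at hx
        exact absurd x.2.1 (not_le.2 hx)
      rw [if_neg hm] at ha
      rw [bspline_eq_zero_of_lt h (m := m) _ hx, mul_zero]
      have := le_knotNum h (m := m - 1) (i := j) (k := k) (by omega) (by omega)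
      omega
    · rw [truncPow, if_neg hx]
      have hM := bspline_marsden (k := k) h x ((m : ℝ) / (k + 1)) (p - l)
      rw [show p - (p - l) = l by omega, ← neg_sub, neg_pow] at hM
      have : ∑ j ∈ Ico a n, c j * bspline p r k j x = ∑ j ∈ range n, c j * bspline p r k j x := by
        refine sum_subset (fun j hj => ?_) fun j hj hj' => hzero x (not_lt.1 hx) j ?_
        · rw [mem_Ico] at hj; exact mem_range.2 hj.2
        · rw [mem_Ico] at hj'; rw [mem_range] at hj; omega
      rw [this, hM]
      ring

/-- Same truncation of Marsden's identity, now keeping the low indices. The mirrored breakpoint is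
m'/(k+1) with m' = k + 1 - m. -/
theorem truncPowSymm_mem_span (h : r < p) {q m l : ℕ} (hq : q ≤ p + 1)
    (hi : (m, l) ∈ truncPowIdx p r k q) :
    truncPowSymm k (m, l) ∈ span ℝ (bspline p r k '' range (numBSplines p r k - q)) := by
  rw [mem_truncPowIdx] at hi
  have hlp : l ≤ p := by omega
  have hmk : m ≤ k := by omega
  set n := numBSplines p r k with hn
  set m' := k + 1 - m with hm'
  have hτ : (m' : ℝ) / (k + 1) = 1 - m / (k + 1) := by
    rw [hm', Nat.cast_sub (by omega)]; push_cast; field_simp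
  set c : ℕ → ℝ := fun i =>
    (taylor ((m' : ℝ) / (k + 1)) (dualPoly (knot p r k) p i)).coeff (p - l) with hcdef
  have hc : ∀ i, c i = (taylor ((m' : ℝ) / (k + 1)) (dualPoly (knot p r k) p i)).coeff (p - l) :=
    fun _ => rfl
  have hn' : n = p + 1 + k * (p - r) := rfl
  set a := if m = 0 then n - q else m' * (p - r) with ha
  have hmul : m ≠ 0 → m' * (p - r) ≤ k * (p - r) := fun h0 => Nat.mul_le_mul_right _ (by omega)
  have hqa : a ≤ n - q := by
    rw [ha]; split_ifs with h0
    · rfl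
    · have := hmul h0; omega
  suffices H : truncPowSymm k (m, l) ∈ span ℝ (bspline p r k '' range a) from
    span_mono (Set.image_mono (by exact_mod_cast range_subset_range.2 hqa)) H
  -- For m = 0 the end point x = 1 has to be included, since B-splines need not vanish there.
  have hzero : ∀ x : I01, m = 0 ∨ (x : ℝ) < (m' : ℝ) / (k + 1) → ∀ j < n, a ≤ j →
      c j * bspline p r k j x = 0 := by
    intro x hx j hjn hj
    by_cases hm : m = 0
    · rw [if_pos hm] at ha
      rw [hc, coeff_taylor_dualPoly_eq_zero (b := n) (μ := j + 1 + p - n), zero_mul]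
      · intro i hi _
        rw [knot_eq_one h hi, hτ, hm]; simp
      · omega
      · omega
      · omega
    · rw [if_neg hm] at ha
      have e : m' * (p - r) = (m' - 1) * (p - r) + (p - r) := by
        conv_lhs => rw [show m' = m' - 1 + 1 by omega, Nat.succ_mul]
      by_cases hj' : j ≤ p + (m' - 1) * (p - r)
      · rw [hc, coeff_taylor_dualPoly_eq_zero (b := p + 1 + (m' - 1) * (p - r)) (μ := p - r),
          zero_mul]
        · intro i hi1 hi2
          rw [knot_eq h, le_antisymm (knotNum_le h (m := m') (by omega))
            (show m' ≤ _ by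
              have := le_knotNum h (m := m' - 1) (i := i) (k := k) (by omega) (by omega)
              omega)]
        · omega
        · omega
        · omega
      · rw [bspline_eq_zero_of_lt h (m := m') _ (hx.resolve_left hm), mul_zero]
        have := le_knotNum h (m := m' - 1) (i := j) (k := k) (by omega) (by omega)
        omega
  have hval : truncPowSymm k (m, l) = fun x : I01 =>
      if (m' : ℝ) / (k + 1) < x then 0 else ((m' : ℝ) / (k + 1) - x) ^ l := by
    ext x
    simp only [truncPowSymm, truncPow, Function.comp, unitInterval.coe_symm_eq, hτ]
    have : (1 - (x : ℝ) < m / (k + 1)) ↔ (1 - m / ((k : ℝ) + 1) < x) := by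
      constructor <;> intro <;> linarith
    simp only [this]
    split_ifs
    · rfl
    · congr 1; ring
  rw [hval]
  refine sum_mul_mem_span (c := c) (e := p.choose (p - l)) ?_ fun x => ?_
  · have := Nat.choose_pos (show p - l ≤ p by omega)
    exact_mod_cast this.ne'
  · by_cases hx : m = 0 ∨ (x : ℝ) < (m' : ℝ) / (k + 1)
    · have hx' : ¬ ((m' : ℝ) / (k + 1) < x) := by
        rcases hx with hx | hx
        · rw [hτ, hx]; simpa using x.2.2
        · exact not_lt.2 hx.le
      rw [if_neg hx']
      have hM := bspline_marsden (k := k) h x ((m' : ℝ) / (k + 1)) (p - l)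
      rw [show p - (p - l) = l by omega] at hM
      have : ∑ j ∈ range a, c j * bspline p r k j x = ∑ j ∈ range n, c j * bspline p r k j x := by
        refine sum_subset (fun j hj => ?_) fun j hj hj' => hzero x hx j (mem_range.1 hj) ?_
        · rw [mem_range] at *; omega
        · simpa using hj'
      rw [this, hM]
      ring
    · push Not at hx
      -- At the breakpoint itself the value is 0 ^ l, which is zero because m ≠ 0 forces l ≥ r + 1.
      have hr : (if (m' : ℝ) / (k + 1) < x then (0 : ℝ) else ((m' : ℝ) / (k + 1) - x) ^ l) = 0 := by
        split_ifs with h1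
        · rfl
        · rw [sub_eq_zero.2 (le_antisymm hx.2 (not_lt.1 h1)), zero_pow (by omega)]
      rw [hr, mul_zero]
      refine sum_eq_zero fun j hj => ?_
      rw [mem_range] at hj
      rw [if_neg hx.1] at ha
      rw [bspline_eq_zero_of_le h (m := m') (knotNum_le h (by omega)) (by omega) hx.2, mul_zero]

/-- The B-splines that vanish to order `q` at `0` span the corresponding truncated powers. -/
theorem span_bspline_Ico (h : r < p) {q : ℕ} (hq : q ≤ p + 1) :
    span ℝ (bspline p r k '' Ico q (numBSplines p r k)) =
      span ℝ (truncPow k '' truncPowIdx p r k q) :=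
  (span_image_eq_of_card_le ((linearIndepOn_truncPow k).mono (coe_truncPowIdx_subset p r k q))
    (fun _ hi => truncPow_mem_span h hq hi) (by rw [card_truncPowIdx hq, Nat.card_Ico])).1

/-- The B-splines that vanish to order `q` at `1` span the corresponding mirrored truncated
powers. -/
theorem span_bspline_range (h : r < p) {q : ℕ} (hq : q ≤ p + 1) :
    span ℝ (bspline p r k '' range (numBSplines p r k - q)) =
      span ℝ (truncPowSymm k '' truncPowIdx p r k q) :=
  (span_image_eq_of_card_le ((linearIndepOn_truncPowSymm k).mono (coe_truncPowIdx_subset p r k q))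
    (fun _ hi => truncPowSymm_mem_span h hq hi) (by rw [card_truncPowIdx hq, card_range])).1

theorem linearIndepOn_bspline (h : r < p) :
    LinearIndepOn ℝ (bspline p r k) (range (numBSplines p r k) : Set ℕ) := by
  rw [range_eq_Ico]
  exact (span_image_eq_of_card_le
    ((linearIndepOn_truncPow k).mono (coe_truncPowIdx_subset p r k 0))
    (fun _ hi => truncPow_mem_span h (Nat.zero_le _) hi)
    (by rw [card_truncPowIdx (Nat.zero_le _), Nat.card_Ico])).2

theorem span_bspline_Ico_mono {p₁ r₁ p₂ r₂ q : ℕ} (h₁ : r₁ < p₁) (h₂ : r₂ < p₂) (hp : p₁ ≤ p₂)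
    (hr : r₂ ≤ r₁) (hq : q ≤ p₁ + 1) :
    span ℝ (bspline p₁ r₁ k '' Ico q (numBSplines p₁ r₁ k)) ≤
      span ℝ (bspline p₂ r₂ k '' Ico q (numBSplines p₂ r₂ k)) := by
  rw [span_bspline_Ico h₁ hq, span_bspline_Ico h₂ (by omega)]
  exact span_mono (Set.image_mono (by exact_mod_cast truncPowIdx_subset hp hr))

theorem span_bspline_range_mono {p₁ r₁ p₂ r₂ q : ℕ} (h₁ : r₁ < p₁) (h₂ : r₂ < p₂) (hp : p₁ ≤ p₂)
    (hr : r₂ ≤ r₁) (hq : q ≤ p₁ + 1) :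
    span ℝ (bspline p₁ r₁ k '' range (numBSplines p₁ r₁ k - q)) ≤
      span ℝ (bspline p₂ r₂ k '' range (numBSplines p₂ r₂ k - q)) := by
  rw [span_bspline_range h₁ hq, span_bspline_range h₂ (by omega)]
  exact span_mono (Set.image_mono (by exact_mod_cast truncPowIdx_subset hp hr))

end SplineSpace

/-! ### Coefficients in the fine basis and truncation -/

section Representation

variable {p₁ r₁ p₂ r₂ k : ℕ}

theorem linearIndependent_bspline_fin {p r k : ℕ} (h : r < p) :
    LinearIndependent ℝ fun j : Fin (numBSplines p r k) => bspline p r k j := by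
  have h1 := linearIndepOn_bspline (k := k) h
  exact LinearIndependent.comp h1
    (fun j : Fin (numBSplines p r k) => ⟨(j : ℕ), by simp⟩)
    fun a b hab => Fin.ext (congrArg Subtype.val hab)

/-- Linear combinations of B-splines with indices in `J`, as sums over all indices. -/
theorem exists_coeff_of_mem_span {p r k : ℕ} {J : Finset ℕ} {f : I01 → ℝ}
    (hJ : J ⊆ range (numBSplines p r k)) (hf : f ∈ span ℝ (bspline p r k '' J)) :
    ∃ μ : Fin (numBSplines p r k) → ℝ, (∀ j : Fin (numBSplines p r k), (j : ℕ) ∉ J → μ j = 0) ∧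
      f = ∑ j, μ j • bspline p r k j := by
  rw [Submodule.mem_span_image_finset_iff_exists_fun'] at hf
  obtain ⟨c, rfl⟩ := hf
  refine ⟨fun j => if (j : ℕ) ∈ J then c j else 0, fun j hj => if_neg hj, ?_⟩
  rw [Fin.sum_univ_eq_sum_range (fun j => (if j ∈ J then c j else 0) • bspline p r k j)]
  simp only [ite_smul, zero_smul]
  rw [sum_ite_mem, inter_eq_right.2 hJ]

theorem isRepresentation_unique (h₂ : r₂ < p₂) {i : ℕ} {μ ν : Fin (numBSplines p₂ r₂ k) → ℝ}
    (hμ : IsRepresentation p₁ r₁ p₂ r₂ k i μ) (hν : IsRepresentation p₁ r₁ p₂ r₂ k i ν) :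
    μ = ν := by
  have h := Fintype.linearIndependent_iff.1 (linearIndependent_bspline_fin (k := k) h₂)
    (fun j => μ j - ν j) (by
      simp only [sub_smul, sum_sub_distrib]
      rw [← hμ, ← hν, sub_self])
  ext j
  exact sub_eq_zero.1 (h j)

theorem existsUnique_isRepresentation (h₁ : r₁ < p₁) (h₂ : r₂ < p₂) (hp : p₁ ≤ p₂)
    (hr : r₂ ≤ r₁) {i : ℕ} (hi : i < numBSplines p₁ r₁ k) :
    ∃! μ, IsRepresentation p₁ r₁ p₂ r₂ k i μ := by
  have hm : bspline p₁ r₁ k i ∈ span ℝ (bspline p₂ r₂ k '' Ico 0 (numBSplines p₂ r₂ k)) :=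
    span_bspline_Ico_mono h₁ h₂ hp hr (Nat.zero_le _) (subset_span ⟨i, by simpa using hi, rfl⟩)
  obtain ⟨μ, -, hμ⟩ := exists_coeff_of_mem_span (by rw [range_eq_Ico]) hm
  exact ⟨μ, hμ, fun ν hν => isRepresentation_unique h₂ hν hμ⟩

theorem coeff_spec (h₁ : r₁ < p₁) (h₂ : r₂ < p₂) (hp : p₁ ≤ p₂) (hr : r₂ ≤ r₁) {i : ℕ}
    (hi : i < numBSplines p₁ r₁ k) :
    bspline p₁ r₁ k i = ∑ j, coeff p₁ r₁ p₂ r₂ k i j • bspline p₂ r₂ k j :=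
  Classical.epsilon_spec (p := IsRepresentation p₁ r₁ p₂ r₂ k i)
    (existsUnique_isRepresentation h₁ h₂ hp hr hi).exists

theorem coeff_eq_zero (h₁ : r₁ < p₁) (h₂ : r₂ < p₂) (hp : p₁ ≤ p₂) (hr : r₂ ≤ r₁) {i : ℕ}
    (hi : i < numBSplines p₁ r₁ k) {J : Finset ℕ} (hJ : J ⊆ range (numBSplines p₂ r₂ k))
    (hf : bspline p₁ r₁ k i ∈ span ℝ (bspline p₂ r₂ k '' J)) {j : Fin (numBSplines p₂ r₂ k)}
    (hj : (j : ℕ) ∉ J) : coeff p₁ r₁ p₂ r₂ k i j = 0 := by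
  obtain ⟨μ, hμ0, hμ⟩ := exists_coeff_of_mem_span hJ hf
  rw [isRepresentation_unique h₂ (coeff_spec h₁ h₂ hp hr hi) hμ, hμ0 j hj]

/-- The indices `s + 1, …, n - s - 2`. -/
def innerIdx (s n : ℕ) : Finset ℕ := Icc (s + 1) (n - s - 2)

variable {s : ℕ}

theorem truncBSpline_mem_span (i : ℕ) :
    truncBSpline s p₁ r₁ p₂ r₂ k i ∈
      span ℝ (bspline p₂ r₂ k '' innerIdx s (numBSplines p₂ r₂ k)) := by
  refine sum_mem fun j hj => smul_mem _ _ (subset_span ⟨j, ?_, rfl⟩)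
  simpa [innerIdx] using hj

theorem bspline_sub_truncBSpline (h₁ : r₁ < p₁) (h₂ : r₂ < p₂) (hp : p₁ ≤ p₂) (hr : r₂ ≤ r₁)
    {i : ℕ} (hi : i < numBSplines p₁ r₁ k) :
    bspline p₁ r₁ k i - truncBSpline s p₁ r₁ p₂ r₂ k i =
      ∑ j ∈ univ.filter (fun j : Fin (numBSplines p₂ r₂ k) =>
        ¬ (s + 1 ≤ (j : ℕ) ∧ (j : ℕ) ≤ numBSplines p₂ r₂ k - s - 2)),
        coeff p₁ r₁ p₂ r₂ k i j • bspline p₂ r₂ k j := by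
  rw [coeff_spec h₁ h₂ hp hr hi, sub_eq_iff_eq_add', truncBSpline, sum_filter_add_sum_filter_not]

/-- Nestedness with vanishing order s + 1, applied at 0 and at 1, gives two representations that
avoid the low and the high indices respectively. By uniqueness both describe `coeff`, so nothing is
cut off. -/
theorem truncBSpline_eq_bspline (h₁ : r₁ < p₁) (h₂ : r₂ < p₂) (hp : p₁ ≤ p₂) (hr : r₂ ≤ r₁)
    (hs : s ≤ p₁) {i : ℕ} (hi : i ∈ innerIdx s (numBSplines p₁ r₁ k)) :
    truncBSpline s p₁ r₁ p₂ r₂ k i = bspline p₁ r₁ k i := by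
  rw [innerIdx, mem_Icc] at hi
  have hi' : i < numBSplines p₁ r₁ k := by omega
  refine (sub_eq_zero.1 ?_).symm
  rw [bspline_sub_truncBSpline h₁ h₂ hp hr hi']
  refine sum_eq_zero fun j hj => ?_
  rw [mem_filter] at hj
  have hj2 := j.2
  by_cases hj1 : s + 1 ≤ (j : ℕ)
  · rw [coeff_eq_zero h₁ h₂ hp hr hi' (J := range (numBSplines p₂ r₂ k - (s + 1))), zero_smul]
    · exact range_subset_range.2 (Nat.sub_le _ _)
    · refine span_bspline_range_mono h₁ h₂ hp hr (by omega) (subset_span ⟨i, ?_, rfl⟩)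
      rw [mem_coe, mem_range]; omega
    · rw [mem_range]; omega
  · rw [coeff_eq_zero h₁ h₂ hp hr hi' (J := Ico (s + 1) (numBSplines p₂ r₂ k)), zero_smul]
    · rw [range_eq_Ico]; exact Ico_subset_Ico_left (Nat.zero_le _)
    · refine span_bspline_Ico_mono h₁ h₂ hp hr (by omega) (subset_span ⟨i, ?_, rfl⟩)
      rw [mem_coe, mem_Ico]; omega
    · rw [mem_Ico]; omega

end Representation

/-! ### Independence of the univariate truncated B-splines -/

section Truncation

/-- A spline of maximal smoothness with a zero at `0` that vanishes on the second knot interval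
vanishes on the first one too. -/
theorem eq_zero_of_vanishes {k q : ℕ} (hk : 1 ≤ k) {f : I01 → ℝ}
    (hf : f ∈ span ℝ (truncPow k '' truncPowIdx (q + 1) q k 1))
    (hv : ∀ x : I01, 1 / ((k : ℝ) + 1) < x → (x : ℝ) < 2 / ((k : ℝ) + 1) → f x = 0) :
    ∀ x : I01, (x : ℝ) < 2 / ((k : ℝ) + 1) → f x = 0 := by
  have hk0 : (0 : ℝ) < (k : ℝ) + 1 := by positivity
  -- Maximal smoothness leaves a single truncated power at breakpoint 1, and exponents at 0 start
  -- from 1.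
  have hform : ∃ (P : ℝ[X]) (c : ℝ), P.eval 0 = 0 ∧ ∀ x : I01, (x : ℝ) < 2 / ((k : ℝ) + 1) →
      f x = P.eval (x : ℝ) + c * truncPow k (1, q + 1) x := by
    clear hv
    induction hf using span_induction with
    | mem g hg =>
      obtain ⟨⟨m, l⟩, hi, rfl⟩ := hg
      rw [mem_coe, mem_truncPowIdx] at hi
      rcases hi with ⟨rfl, h1, h2⟩ | ⟨h1, h2, h3, h4⟩
      · refine ⟨X ^ l, 0, by simp; omega, fun x _ => ?_⟩
        have := x.2.1
        simp [truncPow, not_lt.2 this]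
      · obtain rfl : l = q + 1 := by omega
        rcases h1.eq_or_lt with rfl | h1
        · exact ⟨0, 1, by simp, fun x _ => by simp⟩
        · refine ⟨0, 0, by simp, fun x hx => ?_⟩
          rw [truncPow, if_pos]
          · simp
          · refine hx.trans_le ?_
            gcongr; exact_mod_cast h1
    | zero => exact ⟨0, 0, by simp, by simp⟩
    | add g₁ g₂ _ _ h₁ h₂ =>
      obtain ⟨P₁, c₁, h₁, h₁'⟩ := h₁
      obtain ⟨P₂, c₂, h₂, h₂'⟩ := h₂
      refine ⟨P₁ + P₂, c₁ + c₂, by simp [h₁, h₂], fun x hx => ?_⟩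
      rw [Pi.add_apply, h₁' x hx, h₂' x hx, eval_add]; ring
    | smul a g _ h =>
      obtain ⟨P, c, h, h'⟩ := h
      refine ⟨a • P, a * c, by simp [h], fun x hx => ?_⟩
      rw [Pi.smul_apply, h' x hx, eval_smul, smul_eq_mul, smul_eq_mul]; ring
  obtain ⟨P, c, hP, hform⟩ := hform
  have h21 : 2 / ((k : ℝ) + 1) ≤ 1 := by
    rw [div_le_one hk0]; have : (1 : ℝ) ≤ k := by exact_mod_cast hk
    linarith
  have hQ : P + C c * (X - C (1 / ((k : ℝ) + 1))) ^ (q + 1) = 0 := by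
    refine eq_zero_of_infinite_isRoot _
      ((Set.Ioo_infinite (a := 1 / ((k : ℝ) + 1)) (b := 2 / (k + 1)) (by gcongr; norm_num)).mono ?_)
    rintro x ⟨hx1, hx2⟩
    have h0 : (0 : ℝ) < 1 / ((k : ℝ) + 1) := by positivity
    have hx01 : x ∈ Set.Icc (0 : ℝ) 1 := ⟨by linarith, by linarith⟩
    have h := hform ⟨x, hx01⟩ hx2
    rw [hv ⟨x, hx01⟩ hx1 hx2, truncPow, if_neg] at h
    · simp only [Set.mem_ofPred_eq, IsRoot, eval_add, eval_mul, eval_C, eval_pow, eval_sub, eval_X]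
      rw [h]; simp
    · simpa using hx1.le
  -- Evaluation at 0 leaves c (-1/(k+1))^(q+1) = 0.
  have hc : c = 0 := by
    have h := congrArg (eval 0) hQ
    simp only [eval_add, hP, eval_mul, eval_C, eval_pow, eval_sub, eval_X, zero_sub, zero_add,
      eval_zero] at h
    refine (mul_eq_zero.1 h).resolve_right (pow_ne_zero _ (neg_ne_zero.2 ?_))
    positivity
  intro x hx
  have hP0 : P = 0 := by simpa [hc] using hQ
  rw [hform x hx, hP0, hc]; simp

variable {s p₁ k : ℕ}

theorem numBSplines_add_one {p r : ℕ} (h : r + 1 = p) : numBSplines p r k = p + 1 + k := by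
  rw [numBSplines, show p - r = 1 by omega, mul_one]

theorem numBSplines_outer : numBSplines (2 * s + 1) s k = (k + 2) * (s + 1) := by
  rw [numBSplines, show 2 * s + 1 - s = s + 1 by omega]; ring

/-- Inner knots have multiplicity p₂ - r₂ = s + 1, so exactly the s + 1 outermost B-splines at each
end are supported in one end interval. -/
theorem outer_bspline_eq_zero (hk : 1 ≤ k) {j : ℕ} (hj : j < numBSplines (2 * s + 1) s k)
    (hj' : j ∉ innerIdx s (numBSplines (2 * s + 1) s k)) {x : I01}
    (hx1 : 1 / ((k : ℝ) + 1) ≤ x) (hx2 : (x : ℝ) < k / ((k : ℝ) + 1)) :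
    bspline (2 * s + 1) s k j x = 0 := by
  have h : s < 2 * s + 1 := by omega
  rw [innerIdx, mem_Icc] at hj'
  by_cases hjs : j ≤ s
  · refine bspline_eq_zero_of_le h (m := 1) (knotNum_le h ?_) hk (by simpa using hx1)
    omega
  · refine bspline_eq_zero_of_lt h (m := k) ?_ hx2
    obtain ⟨k, rfl⟩ : ∃ k', k = k' + 1 := ⟨k - 1, by omega⟩
    refine le_knotNum h (m := k) (by omega) ?_
    rw [numBSplines_outer] at hj hj'
    rw [show 2 * s + 1 - s = s + 1 by omega]
    have : (k + 1 + 2) * (s + 1) = k * (s + 1) + (3 * s + 3) := by ring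
    omega

/-- The truncated B-splines that vanish at the end points are linearly independent. -/
theorem linearIndepOn_truncBSpline (hs : s + 1 ≤ p₁) (hs' : p₁ ≤ 2 * s + 1) (hk : 2 ≤ k) :
    LinearIndepOn ℝ (truncBSpline s p₁ (p₁ - 1) (2 * s + 1) s k)
      (Icc 1 (numBSplines p₁ (p₁ - 1) k - 2) : Set ℕ) := by
  have hk0 : (0 : ℝ) < (k : ℝ) + 1 := by positivity
  have h₁ : p₁ - 1 < p₁ := by omega
  have h₂ : s < 2 * s + 1 := by omega
  set n := numBSplines p₁ (p₁ - 1) k with hn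
  have hn2 : n = p₁ + 1 + k := numBSplines_add_one (by omega)
  rw [linearIndepOn_finset_iff]
  intro c hc
  set f : I01 → ℝ := ∑ i ∈ Icc 1 (n - 2), c i • bspline p₁ (p₁ - 1) k i with hf
  -- As the truncated combination is zero, `f` consists of the cut-off parts only.
  have hsub : f = ∑ i ∈ Icc 1 (n - 2), c i •
      (bspline p₁ (p₁ - 1) k i - truncBSpline s p₁ (p₁ - 1) (2 * s + 1) s k i) := by
    simp only [smul_sub, sum_sub_distrib]
    rw [hc, sub_zero]
  have hvan : ∀ x : I01, 1 / ((k : ℝ) + 1) ≤ x → (x : ℝ) < k / ((k : ℝ) + 1) → f x = 0 := by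
    intro x hx1 hx2
    rw [hsub, Finset.sum_apply]
    refine sum_eq_zero fun i hi => ?_
    rw [mem_Icc] at hi
    rw [bspline_sub_truncBSpline h₁ h₂ hs' (by omega) (by omega), Pi.smul_apply, Finset.sum_apply,
      sum_eq_zero, smul_zero]
    intro j hj
    rw [Pi.smul_apply, outer_bspline_eq_zero (by omega) j.2 _ hx1 hx2, smul_zero]
    rw [innerIdx, mem_Icc]
    exact (mem_filter.1 hj).2
  have hleft : f ∈ span ℝ (truncPow k '' truncPowIdx (p₁ - 1 + 1) (p₁ - 1) k 1) := by
    rw [show p₁ - 1 + 1 = p₁ by omega, ← span_bspline_Ico h₁ (by omega)]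
    refine sum_mem fun i hi => smul_mem _ _ (subset_span ⟨i, ?_, rfl⟩)
    rw [mem_Icc] at hi
    rw [mem_coe, mem_Ico]; omega
  have hright : f ∘ unitInterval.symm ∈
      span ℝ (truncPow k '' truncPowIdx (p₁ - 1 + 1) (p₁ - 1) k 1) := by
    have h : f ∈ span ℝ (truncPowSymm k '' truncPowIdx p₁ (p₁ - 1) k 1) := by
      rw [← span_bspline_range h₁ (by omega)]
      refine sum_mem fun i hi => smul_mem _ _ (subset_span ⟨i, ?_, rfl⟩)
      rw [mem_Icc] at hi
      rw [mem_coe, mem_range]; omega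
    have h' := mem_map_of_mem (f := LinearMap.funLeft ℝ ℝ unitInterval.symm) h
    have e : LinearMap.funLeft ℝ ℝ unitInterval.symm ∘ truncPowSymm k = truncPow k := by
      ext i x
      simp [truncPowSymm, LinearMap.funLeft_apply]
    rw [Submodule.map_span, ← Set.image_comp, e] at h'
    rwa [show p₁ - 1 + 1 = p₁ by omega]
  have hk2 : (2 : ℝ) ≤ k := by exact_mod_cast hk
  -- Here k ≥ 2 enters: the second interval lies where `f` is known to vanish.
  have h2k : 2 / ((k : ℝ) + 1) ≤ k / (k + 1) := by gcongr
  have h12 : 1 / ((k : ℝ) + 1) < 2 / (k + 1) := by gcongr; norm_num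
  have hsum : (k : ℝ) / (k + 1) = 1 - 1 / (k + 1) := by field_simp; ring
  have hzero : f = 0 := by
    ext x
    by_cases hx : (x : ℝ) < 2 / (k + 1)
    · exact eq_zero_of_vanishes (by omega) hleft
        (fun y hy1 hy2 => hvan y hy1.le (hy2.trans_le h2k)) x hx
    · by_cases hxk : (x : ℝ) < k / (k + 1)
      · exact hvan x (h12.le.trans (not_lt.1 hx)) hxk
      · have h := eq_zero_of_vanishes (by omega) hright (fun y hy1 hy2 => hvan _
          (by rw [unitInterval.coe_symm_eq]; linarith)
          (by rw [unitInterval.coe_symm_eq]; linarith)) (unitInterval.symm x)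
          (by rw [unitInterval.coe_symm_eq]; linarith)
        simpa using h
  have hli := linearIndepOn_bspline (k := k) h₁
  rw [linearIndepOn_iff'] at hli
  refine hli (Icc 1 (n - 2)) c ?_ hzero
  intro i hi
  rw [mem_coe, mem_Icc] at hi
  rw [mem_coe, mem_range]; omega

end Truncation

/-! ### Tensor products -/

section Tensor

variable {u v : ℕ → I01 → ℝ} {A B : Finset ℕ}

theorem linearIndepOn_tensor (hu : LinearIndepOn ℝ u (A : Set ℕ))
    (hv : LinearIndepOn ℝ v (B : Set ℕ)) :
    LinearIndepOn ℝ (fun j : ℕ × ℕ => tensor (u j.1) (v j.2))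
      ((A ×ˢ B : Finset (ℕ × ℕ)) : Set _) := by
  rw [linearIndepOn_finset_iff] at hu hv ⊢
  intro c hc
  -- Freezing y reduces the relation to one among the `u i`; letting y vary then gives relations
  -- among the `v j`.
  have h1 : ∀ y, ∀ i ∈ A, ∑ j ∈ B, c (i, j) * v j y = 0 := by
    intro y
    refine hu (fun i => ∑ j ∈ B, c (i, j) * v j y) ?_
    ext x
    have h := congrFun hc (x, y)
    simp only [sum_product, Finset.sum_apply, Pi.smul_apply, tensor, smul_eq_mul,
      Pi.zero_apply] at h ⊢
    rw [← h]
    refine sum_congr rfl fun i _ => ?_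
    rw [sum_mul]
    exact sum_congr rfl fun j _ => by ring
  rintro ⟨i, j⟩ hij
  rw [mem_product] at hij
  refine hv (fun j => c (i, j)) ?_ j hij.2
  ext y
  simpa using h1 y i hij.1

theorem tensor_mem_span {f g : I01 → ℝ} (hf : f ∈ span ℝ (u '' A)) (hg : g ∈ span ℝ (v '' B)) :
    tensor f g ∈ span ℝ ((fun j : ℕ × ℕ => tensor (u j.1) (v j.2)) ''
      ((A ×ˢ B : Finset (ℕ × ℕ)) : Set _)) := by
  rw [mem_span_image_finset_iff_exists_fun'] at hf hg ⊢
  obtain ⟨a, rfl⟩ := hf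
  obtain ⟨b, rfl⟩ := hg
  refine ⟨fun j => a j.1 * b j.2, ?_⟩
  ext z
  simp only [sum_product, Finset.sum_apply, Pi.smul_apply, tensor, smul_eq_mul, sum_mul_sum]
  exact sum_congr rfl fun i _ => sum_congr rfl fun j _ => by ring

end Tensor

/-! ### Independence of the whole bivariate family -/

section Independence

variable {s p₁ k : ℕ}

/-- Index pairs of the truncated tensor-product B-splines that vanish on the boundary. -/
def truncIdx (n : ℕ) : Finset (ℕ × ℕ) := Icc 1 (n - 2) ×ˢ Icc 1 (n - 2)

/-- Index pairs of the tensor-product B-splines near the boundary. -/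
def boundaryIdx (s n : ℕ) : Finset (ℕ × ℕ) :=
  range n ×ˢ range n \ innerIdx s n ×ˢ innerIdx s n

/-- The two groups lie in spans of complementary sets of fine tensor B-splines, so independence of
each group suffices. -/
theorem linearIndependent_truncBSpline₂_bspline₂ (hs : s + 1 ≤ p₁) (hs' : p₁ ≤ 2 * s + 1)
    (hk : 2 ≤ k) :
    LinearIndependent ℝ (Sum.elim
      (fun j : truncIdx (numBSplines p₁ (p₁ - 1) k) =>
        truncBSpline₂ s p₁ (p₁ - 1) (2 * s + 1) s k j)
      (fun j : boundaryIdx s (numBSplines (2 * s + 1) s k) => bspline₂ (2 * s + 1) s k j)) := by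
  set n := numBSplines (2 * s + 1) s k with hn
  have hn0 : s + 1 ≤ n := by rw [hn, numBSplines]; omega
  have hB : LinearIndepOn ℝ (bspline₂ (2 * s + 1) s k)
      ((range n ×ˢ range n : Finset (ℕ × ℕ)) : Set _) :=
    linearIndepOn_tensor (linearIndepOn_bspline (by omega)) (linearIndepOn_bspline (by omega))
  have hA : LinearIndepOn ℝ (truncBSpline₂ s p₁ (p₁ - 1) (2 * s + 1) s k)
      (truncIdx (numBSplines p₁ (p₁ - 1) k) : Set _) :=
    linearIndepOn_tensor (by exact_mod_cast linearIndepOn_truncBSpline hs hs' hk)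
      (by exact_mod_cast linearIndepOn_truncBSpline hs hs' hk)
  have hsub : boundaryIdx s n ⊆ range n ×ˢ range n := sdiff_subset
  have hinner : innerIdx s n ⊆ range n := by
    intro i hi
    rw [innerIdx, mem_Icc] at hi
    rw [mem_range]; omega
  refine LinearIndependent.sum_type hA (hB.mono (by exact_mod_cast hsub)) ?_
  have hdisj : Disjoint
      (span ℝ (bspline₂ (2 * s + 1) s k '' (innerIdx s n ×ˢ innerIdx s n : Finset (ℕ × ℕ))))
      (span ℝ (bspline₂ (2 * s + 1) s k '' boundaryIdx s n)) := by
    have hd : Disjoint ((innerIdx s n ×ˢ innerIdx s n : Finset (ℕ × ℕ)) : Set (ℕ × ℕ))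
        (boundaryIdx s n) := disjoint_coe.2 disjoint_sdiff
    refine ((linearIndepOn_union_iff hd).1 (hB.mono ?_)).2.2
    rw [← coe_union, coe_subset]
    exact union_subset (product_subset_product hinner hinner) hsub
  refine hdisj.mono ?_ ?_
  · rw [span_le]
    rintro _ ⟨j, rfl⟩
    exact tensor_mem_span (truncBSpline_mem_span _) (truncBSpline_mem_span _)
  · rw [Set.image_eq_range]; rfl

theorem linearIndependent_basisFun (hs : s + 1 ≤ p₁) (hs' : p₁ ≤ 2 * s + 1) (hk : 2 ≤ k) :
    LinearIndependent ℝ (basisFun s p₁ (p₁ - 1) (2 * s + 1) s k) := by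
  set n₁ := numBSplines p₁ (p₁ - 1) k with hn₁
  set n₂ := numBSplines (2 * s + 1) s k with hn₂
  have h2 : n₂ = (k + 2) * (s + 1) := numBSplines_outer
  have h2' : (k + 2) * (s + 1) = k * (s + 1) + (2 * s + 2) := by ring
  have hA₁ : ∀ j ∈ idxS₁ s n₁, j ∈ truncIdx n₁ := by
    rintro ⟨a, b⟩ h
    simp only [idxS₁, truncIdx, mem_product, mem_Icc] at h ⊢
    omega
  have hA₂ : ∀ j ∈ idxS₁barA s n₁, j ∈ truncIdx n₁ := by
    rintro ⟨a, b⟩ h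
    simp only [idxS₁barA, truncIdx, mem_product, mem_Icc, mem_union] at h ⊢
    have : n₁ = p₁ + 1 + k := numBSplines_add_one (by omega)
    omega
  have hA₃ : ∀ j ∈ idxS₁barB s n₁, j ∈ truncIdx n₁ := by
    rintro ⟨a, b⟩ h
    simp only [idxS₁barB, truncIdx, mem_product, mem_Icc, mem_union] at h ⊢
    have : n₁ = p₁ + 1 + k := numBSplines_add_one (by omega)
    omega
  have hB₁ : ∀ j ∈ idxS₂A s n₂, j ∈ boundaryIdx s n₂ := by
    rintro ⟨a, b⟩ h
    simp only [idxS₂A, boundaryIdx, innerIdx, mem_product, mem_Icc, mem_union, mem_sdiff,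
      mem_range] at h ⊢
    omega
  have hB₂ : ∀ j ∈ idxS₂B s n₂, j ∈ boundaryIdx s n₂ := by
    rintro ⟨a, b⟩ h
    simp only [idxS₂B, boundaryIdx, innerIdx, mem_product, mem_Icc, mem_union, mem_sdiff,
      mem_range] at h ⊢
    omega
  -- The functions of S₁ equal their truncations, so the family is an injective reindexing of the
  -- two groups.
  let φ : BasisIdx s p₁ (p₁ - 1) (2 * s + 1) s k → truncIdx n₁ ⊕ boundaryIdx s n₂ := fun
    | .inl j => .inl ⟨j, hA₁ j j.2⟩
    | .inr (.inl (.inl j)) => .inl ⟨j, hA₂ j j.2⟩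
    | .inr (.inl (.inr j)) => .inl ⟨j, hA₃ j j.2⟩
    | .inr (.inr (.inl j)) => .inr ⟨j, hB₁ j j.2⟩
    | .inr (.inr (.inr j)) => .inr ⟨j, hB₂ j j.2⟩
  have hφ : Function.Injective φ := by
    rintro (⟨⟨a, b⟩, h⟩ | (⟨⟨a, b⟩, h⟩ | ⟨⟨a, b⟩, h⟩) | (⟨⟨a, b⟩, h⟩ | ⟨⟨a, b⟩, h⟩))
      (⟨⟨a', b'⟩, h'⟩ | (⟨⟨a', b'⟩, h'⟩ | ⟨⟨a', b'⟩, h'⟩) | (⟨⟨a', b'⟩, h'⟩ | ⟨⟨a', b'⟩, h'⟩)) e <;>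
    simp only [φ, Sum.inl.injEq, Sum.inr.injEq, Subtype.mk.injEq, Prod.mk.injEq, reduceCtorEq]
      at e ⊢ <;>
    first
    | exact e
    | (obtain ⟨rfl, rfl⟩ := e
       simp only [idxS₁, idxS₁barA, idxS₁barB, idxS₂A, idxS₂B, mem_product, mem_Icc,
         mem_union] at h h'
       simp only [← hn₁, ← hn₂] at h h'
       omega)
  have hcomp : basisFun s p₁ (p₁ - 1) (2 * s + 1) s k = Sum.elim
      (fun j : truncIdx n₁ => truncBSpline₂ s p₁ (p₁ - 1) (2 * s + 1) s k j)
      (fun j : boundaryIdx s n₂ => bspline₂ (2 * s + 1) s k j) ∘ φ := by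
    funext x
    rcases x with ⟨j, hj⟩ | (⟨j, hj⟩ | ⟨j, hj⟩) | (⟨j, hj⟩ | ⟨j, hj⟩)
    · rw [idxS₁, mem_product] at hj
      have e := fun i hi => truncBSpline_eq_bspline (k := k) (r₁ := p₁ - 1) (r₂ := s) (s := s)
        (i := i) (by omega) (by omega) hs' (by omega) (by omega) hi
      simp only [basisFun, bspline₂, Function.comp, φ, Sum.elim_inl, truncBSpline₂]
      rw [e _ hj.1, e _ hj.2]
    all_goals rfl
  rw [hcomp]
  exact (linearIndependent_truncBSpline₂_bspline₂ hs hs' hk).comp φ hφ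

end Independence

/-! ### Direct sums and the dimension count -/

section Spaces

variable (s p₁ r₁ p₂ r₂ k : ℕ)

theorem S₁_eq : S₁ s p₁ r₁ k =
    span ℝ (basisFun s p₁ r₁ p₂ r₂ k '' Set.range Sum.inl) := by
  rw [S₁, Set.image_eq_range, ← Set.range_comp]; rfl

theorem S₁barA_eq : S₁barA s p₁ r₁ p₂ r₂ k =
    span ℝ (basisFun s p₁ r₁ p₂ r₂ k '' Set.range (Sum.inr ∘ Sum.inl ∘ Sum.inl)) := by
  rw [S₁barA, Set.image_eq_range, ← Set.range_comp]; rfl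

theorem S₁barB_eq : S₁barB s p₁ r₁ p₂ r₂ k =
    span ℝ (basisFun s p₁ r₁ p₂ r₂ k '' Set.range (Sum.inr ∘ Sum.inl ∘ Sum.inr)) := by
  rw [S₁barB, Set.image_eq_range, ← Set.range_comp]; rfl

theorem S₂A_eq : S₂A s p₂ r₂ k =
    span ℝ (basisFun s p₁ r₁ p₂ r₂ k '' Set.range (Sum.inr ∘ Sum.inr ∘ Sum.inl)) := by
  rw [S₂A, Set.image_eq_range, ← Set.range_comp]; rfl

theorem S₂B_eq : S₂B s p₂ r₂ k =
    span ℝ (basisFun s p₁ r₁ p₂ r₂ k '' Set.range (Sum.inr ∘ Sum.inr ∘ Sum.inr)) := by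
  rw [S₂B, Set.image_eq_range, ← Set.range_comp]; rfl

theorem S₁bar_eq : S₁bar s p₁ r₁ p₂ r₂ k =
    span ℝ (basisFun s p₁ r₁ p₂ r₂ k '' Set.range (Sum.inr ∘ Sum.inl)) := by
  rw [S₁bar, S₁barA_eq, S₁barB_eq, ← span_union, ← Set.image_union]
  congr 2
  ext x
  simp

theorem S₂_eq : S₂ s p₂ r₂ k =
    span ℝ (basisFun s p₁ r₁ p₂ r₂ k '' Set.range (Sum.inr ∘ Sum.inr)) := by
  rw [S₂, S₂A_eq s p₁ r₁, S₂B_eq s p₁ r₁, ← span_union, ← Set.image_union]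
  congr 2
  ext x
  simp

theorem mixedSpace_eq : mixedSpace s p₁ r₁ p₂ r₂ k =
    span ℝ (Set.range (basisFun s p₁ r₁ p₂ r₂ k)) := by
  rw [mixedSpace, S₁_eq s p₁ r₁ p₂ r₂, S₁bar_eq, S₂_eq s p₁ r₁, ← span_union, ← span_union,
    ← Set.image_union, ← Set.image_union,
    ← Set.image_univ (f := basisFun s p₁ r₁ p₂ r₂ k)]
  congr 2
  rw [Set.eq_univ_iff_forall]
  rintro (x | x | x) <;> simp

variable {s p₁ r₁ p₂ r₂ k}

/-- Disjoint index sets of one independent family have spans that meet trivially. -/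
theorem iSupIndep_spaces (h : LinearIndependent ℝ (basisFun s p₁ r₁ p₂ r₂ k)) :
    iSupIndep ![S₁ s p₁ r₁ k, S₁bar s p₁ r₁ p₂ r₂ k, S₂ s p₂ r₂ k] := by
  rw [S₁_eq s p₁ r₁ p₂ r₂, S₁bar_eq, S₂_eq s p₁ r₁]
  have key : ∀ A B C : Set (BasisIdx s p₁ r₁ p₂ r₂ k), Disjoint A B → Disjoint A C →
      Disjoint (span ℝ (basisFun s p₁ r₁ p₂ r₂ k '' A))
        (span ℝ (basisFun s p₁ r₁ p₂ r₂ k '' B) ⊔ span ℝ (basisFun s p₁ r₁ p₂ r₂ k '' C)) := by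
    intro A B C hB hC
    rw [← span_union, ← Set.image_union]
    exact h.disjoint_span_image (Set.disjoint_union_right.2 ⟨hB, hC⟩)
  intro i
  fin_cases i
  · refine (key _ (Set.range (Sum.inr ∘ Sum.inl)) (Set.range (Sum.inr ∘ Sum.inr)) ?_ ?_).mono_right
      (iSup₂_le fun j hj => ?_)
    · rw [Set.disjoint_left]; rintro _ ⟨x, rfl⟩; simp
    · rw [Set.disjoint_left]; rintro _ ⟨x, rfl⟩; simp
    · fin_cases j
      · exact absurd rfl hj
      · exact le_sup_left
      · exact le_sup_right
  · refine (key _ (Set.range Sum.inl) (Set.range (Sum.inr ∘ Sum.inr)) ?_ ?_).mono_right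
      (iSup₂_le fun j hj => ?_)
    · rw [Set.disjoint_left]; rintro _ ⟨x, rfl⟩; simp
    · rw [Set.disjoint_left]; rintro _ ⟨x, rfl⟩; simp
    · fin_cases j
      · exact le_sup_left
      · exact absurd rfl hj
      · exact le_sup_right
  · refine (key _ (Set.range Sum.inl) (Set.range (Sum.inr ∘ Sum.inl)) ?_ ?_).mono_right
      (iSup₂_le fun j hj => ?_)
    · rw [Set.disjoint_left]; rintro _ ⟨x, rfl⟩; simp
    · rw [Set.disjoint_left]; rintro _ ⟨x, rfl⟩; simp
    · fin_cases j
      · exact le_sup_left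
      · exact le_sup_right
      · exact absurd rfl hj

theorem card_basisIdx (hs : s + 1 ≤ p₁) (hk : 2 * (s + 1) ≤ p₁ + k) :
    (Fintype.card (BasisIdx s p₁ (p₁ - 1) (2 * s + 1) s k) : ℤ) =
      4 * ((s : ℤ) + 1) ^ 2 * (k + 1) + (k + s) ^ 2
        + (p₁ - (s + 1)) * (p₁ + 2 * k + s - 1) := by
  have hu : ∀ a b c d : ℕ, b < c → (Icc a b ∪ Icc c d).card = (b + 1 - a) + (d + 1 - c) := by
    intro a b c d hbc
    rw [card_union_of_disjoint, Nat.card_Icc, Nat.card_Icc]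
    rw [disjoint_left]
    intro x hx hx'
    rw [mem_Icc] at hx hx'
    omega
  simp only [BasisIdx, Fintype.card_sum, Fintype.card_coe]
  rw [numBSplines_outer, numBSplines_add_one (by omega)]
  -- Thus M₁ has `m + 1` elements, and no natural-number subtraction below is cut off at zero.
  obtain ⟨m, hm⟩ : ∃ m, p₁ + 1 + k = m + (2 * s + 3) := ⟨p₁ + 1 + k - (2 * s + 3), by omega⟩
  have h2 : (k + 2) * (s + 1) = k * (s + 1) + (2 * s + 2) := by ring
  rw [hm, h2, idxS₁, idxS₁barA, idxS₁barB, idxS₂A, idxS₂B]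
  simp only [card_product]
  rw [hu _ _ _ _ (by omega), hu _ _ _ _ (by omega)]
  simp only [Nat.card_Icc]
  rw [show m + (2 * s + 3) - s - 2 + 1 - (s + 1) = m + 1 by omega,
    show s + 1 - 1 + (m + (2 * s + 3) - 2 + 1 - (m + (2 * s + 3) - s - 1)) = 2 * s by omega,
    show m + (2 * s + 3) - 2 + 1 - 1 = m + 2 * s + 1 by omega,
    show s + 1 - 0 + (k * (s + 1) + (2 * s + 2) - 1 + 1 - (k * (s + 1) + (2 * s + 2) - s - 1)) =
      2 * (s + 1) by omega,
    show k * (s + 1) + (2 * s + 2) - 1 + 1 - 0 = k * (s + 1) + (2 * s + 2) by omega,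
    show k * (s + 1) + (2 * s + 2) - s - 2 + 1 - (s + 1) = k * (s + 1) by omega]
  have hp : (p₁ : ℤ) = m + (2 * s + 3) - 1 - k := by omega
  rw [hp]
  push_cast
  ring

end Spaces

end MixedSpline

open MixedSpline
theorem theorem1 (s p₁ r₁ p₂ r₂ k : ℕ)
    (hp₂ : p₂ = 2 * s + 1) (hr₂ : r₂ = s) (hr₁ : r₁ = p₁ - 1)
    (hp₁ : s + 1 ≤ p₁) (hp₁' : p₁ ≤ 2 * s + 1)
    (hk : max (2 * (s + 1) - p₁) 2 ≤ k) :
    -- the coefficients used for the truncation exist and are unique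
    (∀ i < numBSplines p₁ r₁ k, ∃! μ, IsRepresentation p₁ r₁ p₂ r₂ k i μ) ∧
    -- all basis functions together are linearly independent
    LinearIndependent ℝ (basisFun s p₁ r₁ p₂ r₂ k) ∧
    -- and form a basis of the mixed space
    (∃ b : Module.Basis (BasisIdx s p₁ r₁ p₂ r₂ k) ℝ (mixedSpace s p₁ r₁ p₂ r₂ k),
      ∀ j, (b j : I01 × I01 → ℝ) = basisFun s p₁ r₁ p₂ r₂ k j) ∧
    -- the sums defining the spaces are direct
    iSupIndep ![S₁ s p₁ r₁ k, S₁bar s p₁ r₁ p₂ r₂ k, S₂ s p₂ r₂ k] ∧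
    Disjoint (S₁barA s p₁ r₁ p₂ r₂ k) (S₁barB s p₁ r₁ p₂ r₂ k) ∧
    Disjoint (S₂A s p₂ r₂ k) (S₂B s p₂ r₂ k) ∧
    -- dimension formula
    (Module.finrank ℝ (mixedSpace s p₁ r₁ p₂ r₂ k) : ℤ) =
      4 * ((s : ℤ) + 1) ^ 2 * (k + 1) + (k + s) ^ 2
        + (p₁ - (s + 1)) * (p₁ + 2 * k + s - 1) := by
  subst hp₂ hr₂ hr₁
  have hk2 : 2 ≤ k := (le_max_right _ _).trans hk
  -- After substitution `r₂` stands for s. This bound makes M₁ nonempty and serves the count alone.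
  have hk1 : 2 * (r₂ + 1) ≤ p₁ + k := by
    have := (le_max_left _ _).trans hk
    omega
  have hli := linearIndependent_basisFun hp₁ hp₁' hk2
  have hspan := mixedSpace_eq r₂ p₁ (p₁ - 1) (2 * r₂ + 1) r₂ k
  have hb : ∃ b : Module.Basis (BasisIdx r₂ p₁ (p₁ - 1) (2 * r₂ + 1) r₂ k) ℝ
      (mixedSpace r₂ p₁ (p₁ - 1) (2 * r₂ + 1) r₂ k),
      ∀ j, (b j : I01 × I01 → ℝ) = basisFun r₂ p₁ (p₁ - 1) (2 * r₂ + 1) r₂ k j := by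
    rw [hspan]
    exact ⟨Module.Basis.span hli, fun j => congrArg Subtype.val (Module.Basis.span_apply hli j)⟩
  refine ⟨fun i hi => existsUnique_isRepresentation (by omega) (by omega) hp₁' (by omega) hi,
    hli, hb, iSupIndep_spaces hli, ?_, ?_, ?_⟩
  · rw [S₁barA_eq, S₁barB_eq]
    refine hli.disjoint_span_image ?_
    rw [Set.disjoint_left]; rintro _ ⟨x, rfl⟩; simp
  · rw [S₂A_eq r₂ p₁ (p₁ - 1), S₂B_eq r₂ p₁ (p₁ - 1)]
    refine hli.disjoint_span_image ?_
    rw [Set.disjoint_left]; rintro _ ⟨x, rfl⟩; simp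
  · obtain ⟨b, -⟩ := hb
    rw [Module.finrank_eq_card_basis b]
    exact card_basisIdx hp₁ hk1
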